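/- Let $n\ge k\ge 1$ be integers. A word $w=w_1\cdots w_n$ of positive integers, with maximum letter $\mathrm{bk}(w)=\max_i w_i$, is an unrestricted growth function if every $j$ with $1\le j\le \mathrm{bk}(w)$ appears in $w$; let $\mathcal{URG}(n,k)$ be the set of unrestricted growth functions of length $n$ with $\mathrm{bk}(w)=k$. For letters $a,b$ of $w$ write $a\succ b$ if the leftmost occurrence of $a$ in $w$ lies strictly to the right of the rightmost occurrence of $b$, and let $\chi(a\succ b)$ be $1$ if $a \succ b$ and $0$ otherwise. Put \begin{align*} \mathrm{Asc}(w)&=\{i\in\{1,\dots,n-1\}: w_i<w_{i+1}\},\\ \mathrm{bmajMIL}(w)&=\sum_{i=1}^{k-1} i\,\chi(i\succ i+1)+\sum_{i=1}^{n}(w_i-1),\\ \mathrm{bndes}(w)&=k-1-\sum_{i=1}^{k-1}\chi(i\succ i+1),\\ \mathrm{bmajBAST}(w)&=\mathrm{bmajMIL}(w)+\mathrm{pro}(w)+\mathrm{bndes}(w)-n, \end{align*} where $\mathrm{pro}(w)$ is the position of the rightmost $1$ in $w$. Then the pairs $(\mathrm{Asc},\mathrm{bmajMIL})$ and $(\mathrm{Asc},\mathrm{bmajBAST})$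 have the same joint distribution on $\mathcal{URG}(n,k)$: for every set $A$ of positive integers and every integer $m$, $$\#\{w\in\mathcal{URG}(n,k):\mathrm{Asc}(w)=A,\ \mathrm{bmajMIL}(w)=m\}=\#\{w\in\mathcal{URG}(n,k):\mathrm{Asc}(w)=A,\ \mathrm{bmajBAST}(w)=m\}.$$ -/

import Mathlib

/-! Words of length `n` over the positive integers are functions `w : Fin n → ℕ`; the index
`i : Fin n` stands for the position `i + 1 ∈ [n]`, and all position-valued statistics below
are 1-based. -/

namespace URGStat

/-- `bk(w)`, the greatest letter of `w`. -/
def bk {n : ℕ} (w : Fin n → ℕ) : ℕ := Finset.univ.sup w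

/-- Unrestricted growth functions: words of positive letters
in which every `j` with `1 ≤ j ≤ bk(w)` appears. -/
def IsURG {n : ℕ} (w : Fin n → ℕ) : Prop :=
  (∀ i, 1 ≤ w i) ∧ ∀ j ∈ Finset.Icc 1 (bk w), ∃ i, w i = j

instance {n : ℕ} (w : Fin n → ℕ) : Decidable (IsURG w) := by
  unfold IsURG; infer_instance

/-- `URG(n,k)`: the words in `[k]^n` that are unrestricted growth functions with `bk(w) = k`. -/
def URG (n k : ℕ) : Finset (Fin n → ℕ) :=
  (Fintype.piFinset fun _ : Fin n => Finset.Icc 1 k).filter fun w => IsURG w ∧ bk w = k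

/-- `URG(n,k)` is exactly the set of all unrestricted growth functions `w` of length `n`
with `bk(w) = k`. -/
theorem mem_URG {n k : ℕ} {w : Fin n → ℕ} : w ∈ URG n k ↔ IsURG w ∧ bk w = k := by
  simp only [URG, Finset.mem_filter, Fintype.mem_piFinset, Finset.mem_Icc, and_iff_right_iff_imp]
  rintro ⟨h, rfl⟩ i
  exact ⟨h.1 i, Finset.le_sup (f := w) (Finset.mem_univ i)⟩

/-- `Asc(w) = {i : w_i < w_{i+1}} ⊆ [n-1]`, the set of (1-based) positions of ascents. -/
def Asc {n : ℕ} (w : Fin n → ℕ) : Finset ℕ :=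
  (Finset.univ.filter fun i : Fin n =>
    ∃ h : (i : ℕ) + 1 < n, w i < w ⟨(i : ℕ) + 1, h⟩).image fun i : Fin n => (i : ℕ) + 1

/-- `L(w)`: the positions of leftmost occurrences of letters. -/
def L {n : ℕ} (w : Fin n → ℕ) : Finset (Fin n) :=
  Finset.univ.filter fun i => ∀ j, w j = w i → i ≤ j

/-- `R(w)`: the positions of rightmost occurrences of letters. -/
def R {n : ℕ} (w : Fin n → ℕ) : Finset (Fin n) :=
  Finset.univ.filter fun i => ∀ j, w j = w i → j ≤ i

/-- `a ≻ b`: both letters occur in `w`, and the leftmost occurrence of `a` lies to the right of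
the rightmost occurrence of `b`. -/
def Succeeds {n : ℕ} (w : Fin n → ℕ) (a b : ℕ) : Prop :=
  ∃ i ∈ L w, ∃ j ∈ R w, w i = a ∧ w j = b ∧ j < i

instance {n : ℕ} (w : Fin n → ℕ) (a b : ℕ) : Decidable (Succeeds w a b) := by
  unfold Succeeds; infer_instance

/-- `MIL(w) = ∑_i (w_i - 1)`. -/
def MIL {n : ℕ} (w : Fin n → ℕ) : ℤ := ∑ i, ((w i : ℤ) - 1)

/-- `bMAJ(w) = ∑_i i χ(i ≻ i+1)`; the sum is over letters `i`, and only letters up to `bk(w)`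
can contribute. -/
def bMAJ {n : ℕ} (w : Fin n → ℕ) : ℤ :=
  ∑ i ∈ Finset.Icc 1 (bk w), if Succeeds w i (i + 1) then (i : ℤ) else 0

/-- `bmajMIL(w) = bMAJ(w) + MIL(w)`. -/
def bmajMIL {n : ℕ} (w : Fin n → ℕ) : ℤ := bMAJ w + MIL w

/-- Block nondescents: `bndes(w) = bk(w) - 1 - ∑_i χ(i ≻ i+1)`. -/
def bndes {n : ℕ} (w : Fin n → ℕ) : ℤ :=
  (bk w : ℤ) - 1 - ∑ i ∈ Finset.Icc 1 (bk w), if Succeeds w i (i + 1) then 1 else 0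

/-- `pro(w)`: the (1-based) position of the rightmost `1` in `w`
(with value `0` if `w` contains no `1`). -/
def pro {n : ℕ} (w : Fin n → ℕ) : ℕ :=
  (Finset.univ.filter fun i : Fin n => w i = 1).sup fun i : Fin n => (i : ℕ) + 1

/-- `bmajBAST(w) = bmajMIL(w) + pro(w) + bndes(w) - n`. -/
def bmajBAST {n : ℕ} (w : Fin n → ℕ) : ℤ := bmajMIL w + (pro w : ℤ) + bndes w - (n : ℤ)

end URGStat

/-!
The words are treated through generating functions in `ℤ[T;T⁻¹]`, and `n = N + 1`. By Möbius
inversion over `A` (`eq_of_sum_powerset_eq`) the condition `Asc w = A` may be relaxed to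
`Asc w ⊆ A`.

List the positions of a word `w` by increasing letter, and equal letters from right to left. This
gives a permutation `σ`, and `w` is recovered from `σ` together with the bars between consecutive
blocks. The ascents of `σ` must carry a bar, the other places are free. Whether `Asc w ⊆ A` holds
depends on `σ` only (`permClass`). With `d` the number of ascents of `σ` and
`comaj σ = ∑ (N - p)` over the ascents `p`, counted from `0`:

* the words with a given `σ` contribute `T (comaj σ)` times a factor depending on `σ` only
  through `d` to the generating function of `bmajMIL` (`bmajMIL_eq`, `sum_freeWeight`);
* `bmajBAST w = bmajMIL w + (d + σ 0 - N)` (`bmajBAST_eq`), since `σ 0` is the last position of the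
  letter `1`, and every bar which is not at an ascent gives a pair `i ≻ i + 1`.

So it suffices that `(d, comaj)` and `(d, comaj + d + σ 0 - N)` are equidistributed on `permClass`
(`sum_permClass_comaj_eq`). For this, consider arbitrary words with letters in `{0, …, r}`, which
correspond to permutations with multisets of bars. The words whose greatest letter is exactly `r`
have the generating function `∑ σ, T (comaj σ) * H (r - d)`, where `H` is `compositionGF`, and the
words whose least letter is `0`, weighted by the sum of the letters plus `r + σ 0 - N`, have the
generating function `∑ σ, T (comaj σ + d + σ 0 - N) * H (r - d)`, with the same `H`. A bijection
between the two kinds of words (`sum_max_eq_sum_min`) shows that these agree for all `r`; as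
`H 0 = 1`, the factor `H` can be cancelled (`sum_fiber_eq_of_convolution_eq`).

The bijection cuts the positions into segments at the elements of `A`, so that `Asc w ⊆ A` says that
`w` is weakly decreasing on each segment. In the last segment starting with `r`, the letter `r` is
removed from the front and a `0` is put at the end; the letters further to the right, all less than
`r`, are raised by one.
-/

namespace URGStat

open Finset LaurentPolynomial Equiv

/-! ### Sorting the positions of a word -/

/-- The key by which the positions of a word `f` are sorted: first by letter, and among equal
letters from right to left. -/
def sortKey {N : ℕ} (f : Fin (N + 1) → ℕ) (i : Fin (N + 1)) : ℕ ×ₗ (Fin (N + 1))ᵒᵈ :=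
  toLex (f i, OrderDual.toDual i)

/-- `σ` lists the positions of `f` by increasing letter, equal letters being listed from right to
left. -/
def Sorts {N : ℕ} (σ : Perm (Fin (N + 1))) (f : Fin (N + 1) → ℕ) : Prop :=
  StrictMono (sortKey f ∘ σ)

theorem sortKey_lt {N : ℕ} {f : Fin (N + 1) → ℕ} {i j : Fin (N + 1)} :
    sortKey f i < sortKey f j ↔ f i < f j ∨ f i = f j ∧ j < i := by
  simp [sortKey, Prod.Lex.toLex_lt_toLex]

theorem sortKey_injective {N : ℕ} (f : Fin (N + 1) → ℕ) : Function.Injective (sortKey f) := by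
  intro i j h
  exact congrArg (fun x => OrderDual.ofDual (ofLex x).2) h

theorem existsUnique_sorts {N : ℕ} (f : Fin (N + 1) → ℕ) : ∃! σ, Sorts σ f := by
  refine ⟨Tuple.sort (sortKey f), ?_, fun τ hτ => ?_⟩
  · exact (Tuple.monotone_sort (sortKey f)).strictMono_of_injective
      ((sortKey_injective f).comp (Equiv.injective _))
  · have := Tuple.unique_monotone hτ.monotone (Tuple.monotone_sort (sortKey f))
    ext i : 1
    exact sortKey_injective f (congrFun this i)

/-- The permutation that sorts the positions of `f`. -/
noncomputable def sortPerm {N : ℕ} (f : Fin (N + 1) → ℕ) : Perm (Fin (N + 1)) :=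
  (existsUnique_sorts f).choose

theorem sorts_iff_sortPerm_eq {N : ℕ} {f : Fin (N + 1) → ℕ} {σ : Perm (Fin (N + 1))} :
    Sorts σ f ↔ sortPerm f = σ := by
  have h := (existsUnique_sorts f).choose_spec
  exact ⟨fun hσ => (h.2 σ hσ).symm, fun hσ => hσ ▸ h.1⟩

/-- The ascents of `σ`; `p : Fin N` stands for the gap between the entries `p` and `p + 1`. -/
def ascents {N : ℕ} (σ : Perm (Fin (N + 1))) : Finset (Fin N) :=
  univ.filter fun p => σ p.castSucc < σ p.succ

theorem mem_ascents {N : ℕ} {σ : Perm (Fin (N + 1))} {p : Fin N} :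
    p ∈ ascents σ ↔ σ p.castSucc < σ p.succ := by simp [ascents]

theorem sorts_iff {N : ℕ} {f : Fin (N + 1) → ℕ} {σ : Perm (Fin (N + 1))} :
    Sorts σ f ↔ ∀ p : Fin N, f (σ p.castSucc) ≤ f (σ p.succ) ∧
      (p ∈ ascents σ → f (σ p.castSucc) < f (σ p.succ)) := by
  rw [Sorts, Fin.strictMono_iff_lt_succ]
  refine forall_congr' fun p => ?_
  have hne : σ p.castSucc ≠ σ p.succ := σ.injective.ne (Fin.castSucc_lt_succ (i := p)).ne
  rw [Function.comp_apply, Function.comp_apply, sortKey_lt, mem_ascents]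
  constructor
  · rintro (h | ⟨h, h'⟩)
    · exact ⟨h.le, fun _ => h⟩
    · exact ⟨h.le, fun h'' => absurd h'' h'.not_gt⟩
  · rintro ⟨h, h'⟩
    rcases h.lt_or_eq with h1 | h1
    · exact Or.inl h1
    · exact Or.inr ⟨h1, lt_of_le_of_ne (not_lt.1 fun h2 => (h' h2).ne h1) hne.symm⟩

theorem Sorts.monotone {N : ℕ} {f : Fin (N + 1) → ℕ} {σ : Perm (Fin (N + 1))} (h : Sorts σ f) :
    Monotone (f ∘ σ) :=
  Fin.monotone_iff_le_succ.2 fun p => ((sorts_iff.1 h) p).1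

/-- The permutations which sort the words whose ascents all lie in `A`. -/
def permClass (N : ℕ) (A : Finset ℕ) : Finset (Perm (Fin (N + 1))) :=
  univ.filter fun σ => ∀ p : Fin N, (p : ℕ) + 1 ∉ A → σ.symm p.succ < σ.symm p.castSucc

theorem asc_subset_iff_forall {N : ℕ} {f : Fin (N + 1) → ℕ} {A : Finset ℕ} :
    Asc f ⊆ A ↔ ∀ p : Fin N, (p : ℕ) + 1 ∉ A → f p.succ ≤ f p.castSucc := by
  simp only [Asc, subset_iff, mem_image, mem_filter, mem_univ, true_and]
  constructor
  · intro h p hp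
    by_contra hlt
    exact hp (h ⟨p.castSucc, ⟨by simp, not_le.1 hlt⟩, by simp⟩)
  · rintro h _ ⟨i, ⟨hi, hlt⟩, rfl⟩
    by_contra hA
    exact (h ⟨i, by omega⟩ hA).not_gt hlt

theorem Sorts.asc_subset_iff {N : ℕ} {f : Fin (N + 1) → ℕ} {σ : Perm (Fin (N + 1))}
    (h : Sorts σ f) {A : Finset ℕ} : Asc f ⊆ A ↔ σ ∈ permClass N A := by
  rw [asc_subset_iff_forall, permClass, mem_filter, and_iff_right (mem_univ _)]
  refine forall_congr' fun p => imp_congr_right fun _ => ?_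
  rw [← h.lt_iff_lt, Function.comp_apply, Function.comp_apply, apply_symm_apply,
    apply_symm_apply, sortKey_lt, and_iff_left (Fin.castSucc_lt_succ (i := p)), le_iff_lt_or_eq]

/-- A sum over words whose ascents lie in `A`, split according to the sorting permutation. -/
theorem sum_eq_sum_permClass {N : ℕ} (A : Finset ℕ) (S : Finset (Fin (N + 1) → ℕ))
    [DecidablePred fun f : Fin (N + 1) → ℕ => Asc f ⊆ A] (F : (Fin (N + 1) → ℕ) → ℤ[T;T⁻¹]) :
    ∑ f ∈ S with Asc f ⊆ A, F f = ∑ σ ∈ permClass N A, ∑ f ∈ S with sortPerm f = σ, F f := by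
  rw [← sum_fiberwise_of_maps_to (s := S.filter fun f => Asc f ⊆ A) (t := permClass N A)
    (g := sortPerm) (f := F)]
  · refine sum_congr rfl fun σ hσ => ?_
    rw [filter_filter]
    refine sum_congr (filter_congr fun f _ => ?_) fun _ _ => rfl
    refine and_iff_right_of_imp fun h => ?_
    exact (sorts_iff_sortPerm_eq.2 h).asc_subset_iff.2 hσ
  · intro f hf
    exact (sorts_iff_sortPerm_eq.2 rfl).asc_subset_iff.1 (mem_filter.1 hf).2

/-! ### Words as increments along a permutation -/

theorem Iic_fin_last (N : ℕ) : Iic (Fin.last N) = univ := by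
  ext q; simp [Fin.le_last]

theorem sum_Iic_succ {N : ℕ} (e : Fin (N + 1) → ℕ) (p : Fin N) :
    ∑ q ∈ Iic p.succ, e q = ∑ q ∈ Iic p.castSucc, e q + e p.succ := by
  have : Iic p.succ = insert p.succ (Iic p.castSucc) := by
    ext q
    simp only [mem_insert, mem_Iic, Fin.ext_iff, Fin.le_def, Fin.val_succ, Fin.val_castSucc]
    omega
  rw [this, sum_insert (by simp), add_comm]

theorem sum_Iio_succ {N : ℕ} (e : Fin (N + 1) → ℕ) (p : Fin N) :
    ∑ q ∈ Iio p.succ, e q = ∑ q ∈ Iio p.castSucc, e q + e p.castSucc := by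
  have : Iio p.succ = insert p.castSucc (Iio p.castSucc) := by
    ext q
    simp only [mem_insert, mem_Iio, Fin.ext_iff, Fin.lt_def, Fin.val_succ, Fin.val_castSucc]
    omega
  rw [this, sum_insert (by simp), add_comm]

theorem sum_sum_Iic {N : ℕ} (e : Fin (N + 1) → ℕ) :
    ∑ q, ∑ p ∈ Iic q, e p = ∑ p, e p * (N + 1 - (p : ℕ)) := by
  rw [sum_comm' (t' := univ) (s' := fun p => Ici p) (by simp)]
  simp [mul_comm]

theorem sum_sum_Iio {N : ℕ} (e : Fin (N + 1) → ℕ) :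
    ∑ q, ∑ p ∈ Iio q, e p + ∑ p, e p = ∑ p, e p * (N + 1 - (p : ℕ)) := by
  rw [← sum_sum_Iic, ← sum_add_distrib]
  refine sum_congr rfl fun q _ => ?_
  rw [← Iio_insert, sum_insert (by simp), add_comm]

/-- A composition `e` of `r` into `N + 1` parts, positive at the ascents of `σ`, is the sequence of
increments of a word sorted by `σ`; the first part is the least letter, and the greatest letter
is `r`. -/
theorem sum_sorted_max_eq {N : ℕ} (σ : Perm (Fin (N + 1))) (r : ℕ) :
    ∑ f ∈ ((Fintype.piFinset fun _ : Fin (N + 1) => range (r + 1)).filter fun f => ∃ i, f i = r)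
        with sortPerm f = σ, (T (∑ i, (f i : ℤ)) : ℤ[T;T⁻¹]) =
      ∑ e ∈ piAntidiag (univ : Finset (Fin (N + 1))) r with ∀ p ∈ ascents σ, 1 ≤ e p.succ,
        T ((∑ q : Fin (N + 1), e q * (N + 1 - (q : ℕ)) : ℕ) : ℤ) := by
  have key : ∀ f : Fin (N + 1) → ℕ, Sorts σ f → ∀ q, ∑ p ∈ Iic q,
      (Fin.cases (motive := fun _ => ℕ) (f (σ 0))
        (fun p => f (σ p.succ) - f (σ p.castSucc)) p : ℕ) = f (σ q) := by
    intro f hf q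
    induction q using Fin.induction with
    | zero =>
      have : Iic (0 : Fin (N + 1)) = {0} := by ext; simp
      simp [this]
    | succ p ih =>
      rw [sum_Iic_succ, ih]
      have := (sorts_iff.1 hf p).1
      simp only [Fin.cases_succ]
      omega
  refine sum_nbij' (fun f => Fin.cases (motive := fun _ => ℕ) (f (σ 0))
      (fun p => f (σ p.succ) - f (σ p.castSucc)))
    (fun e i => ∑ q ∈ Iic (σ.symm i), e q) ?_ ?_ ?_ ?_ ?_
  · intro f hf
    simp only [mem_filter, Fintype.mem_piFinset, mem_range, ← sorts_iff_sortPerm_eq] at hf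
    obtain ⟨⟨hr, i, hi⟩, hf⟩ := hf
    simp only [mem_filter, mem_piAntidiag, mem_univ, implies_true, and_true]
    refine ⟨?_, fun p hp => ?_⟩
    · have h1 := key f hf (Fin.last N)
      rw [Iic_fin_last] at h1
      rw [h1]
      have h2 := hf.monotone (Fin.le_last (σ.symm i))
      have h3 := hr (σ (Fin.last N))
      simp only [Function.comp_apply, apply_symm_apply] at h2
      omega
    · have := (sorts_iff.1 hf p).2 hp
      simp only [Fin.cases_succ]
      omega
  · intro e he
    simp only [mem_filter, mem_piAntidiag, mem_univ, implies_true, and_true] at he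
    simp only [mem_filter, Fintype.mem_piFinset, mem_range, ← sorts_iff_sortPerm_eq]
    refine ⟨⟨fun i => ?_, σ (Fin.last N), ?_⟩, sorts_iff.2 fun p => ?_⟩
    · rw [← he.1, Nat.lt_succ_iff]
      exact sum_le_sum_of_subset (subset_univ _)
    · rw [symm_apply_apply, Iic_fin_last, he.1]
    · simp only [symm_apply_apply, sum_Iic_succ]
      exact ⟨by omega, fun hp => by have := he.2 p hp; omega⟩
  · intro f hf
    simp only [mem_filter, ← sorts_iff_sortPerm_eq] at hf
    funext i
    rw [key f hf.2, apply_symm_apply]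
  · intro e _
    funext q
    refine Fin.cases ?_ (fun p => ?_) q
    · have : Iic (0 : Fin (N + 1)) = {0} := by ext; simp
      simp [this]
    · simp only [Fin.cases_succ, symm_apply_apply, sum_Iic_succ]
      omega
  · intro f hf
    simp only [mem_filter, ← sorts_iff_sortPerm_eq] at hf
    rw [← sum_sum_Iic, sum_congr rfl fun q _ => key f hf.2 q, ← Equiv.sum_comp σ]
    push_cast
    rfl

/-- A composition `e` of `r` into `N + 1` parts, positive at the ascents of `σ`, is the sequence of
increments of a word sorted by `σ` with least letter `0`; the last part is the difference between
`r` and the greatest letter. -/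
theorem sum_sorted_min_eq {N : ℕ} (σ : Perm (Fin (N + 1))) (r : ℕ) :
    ∑ f ∈ ((Fintype.piFinset fun _ : Fin (N + 1) => range (r + 1)).filter fun f => ∃ i, f i = 0)
        with sortPerm f = σ, (T (∑ i, (f i : ℤ) + r) : ℤ[T;T⁻¹]) =
      ∑ e ∈ piAntidiag (univ : Finset (Fin (N + 1))) r with ∀ p ∈ ascents σ, 1 ≤ e p.castSucc,
        T ((∑ q : Fin (N + 1), e q * (N + 1 - (q : ℕ)) : ℕ) : ℤ) := by
  have h_zero : Iio (0 : Fin (N + 1)) = ∅ := by ext; simp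
  have key : ∀ f : Fin (N + 1) → ℕ, Sorts σ f → f (σ 0) = 0 → ∀ q, ∑ p ∈ Iio q,
      (Fin.lastCases (motive := fun _ => ℕ) (r - f (σ (Fin.last N)))
        (fun p => f (σ p.succ) - f (σ p.castSucc)) p : ℕ) =
        f (σ q) := by
    intro f hf h0 q
    induction q using Fin.induction with
    | zero => simp [h_zero, h0]
    | succ p ih =>
      rw [sum_Iio_succ, ih]
      have := (sorts_iff.1 hf p).1
      simp only [Fin.lastCases_castSucc]
      omega
  have h0 : ∀ f : Fin (N + 1) → ℕ, Sorts σ f → (∃ i, f i = 0) → f (σ 0) = 0 := by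
    rintro f hf ⟨i, hi⟩
    have h2 := hf.monotone (Fin.zero_le (σ.symm i))
    simp only [Function.comp_apply, apply_symm_apply] at h2
    omega
  have total : ∀ f : Fin (N + 1) → ℕ, Sorts σ f → f (σ 0) = 0 → (∀ i, f i < r + 1) → ∑ p,
      (Fin.lastCases (motive := fun _ => ℕ) (r - f (σ (Fin.last N)))
        (fun p => f (σ p.succ) - f (σ p.castSucc)) p : ℕ) =
        r := by
    intro f hf h0 hr
    have h1 := key f hf h0 (Fin.last N)
    have h3 := hr (σ (Fin.last N))
    rw [← Iic_fin_last, ← Iio_insert, sum_insert (by simp), h1, Fin.lastCases_last]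
    omega
  refine sum_nbij' (fun f => Fin.lastCases (motive := fun _ => ℕ) (r - f (σ (Fin.last N)))
    (fun p => f (σ p.succ) - f (σ p.castSucc)))
    (fun e i => ∑ q ∈ Iio (σ.symm i), e q) ?_ ?_ ?_ ?_ ?_
  · intro f hf
    simp only [mem_filter, Fintype.mem_piFinset, mem_range, ← sorts_iff_sortPerm_eq] at hf
    obtain ⟨⟨hr, hi⟩, hf⟩ := hf
    simp only [mem_filter, mem_piAntidiag, mem_univ, implies_true, and_true]
    refine ⟨total f hf (h0 f hf hi) hr, fun p hp => ?_⟩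
    have := (sorts_iff.1 hf p).2 hp
    simp only [Fin.lastCases_castSucc]
    omega
  · intro e he
    simp only [mem_filter, mem_piAntidiag, mem_univ, implies_true, and_true] at he
    simp only [mem_filter, Fintype.mem_piFinset, mem_range, ← sorts_iff_sortPerm_eq]
    refine ⟨⟨fun i => ?_, σ 0, ?_⟩, sorts_iff.2 fun p => ?_⟩
    · rw [← he.1, Nat.lt_succ_iff]
      exact sum_le_sum_of_subset (subset_univ _)
    · rw [symm_apply_apply, h_zero, sum_empty]
    · simp only [symm_apply_apply, sum_Iio_succ]
      exact ⟨by omega, fun hp => by have := he.2 p hp; omega⟩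
  · intro f hf
    simp only [mem_filter, ← sorts_iff_sortPerm_eq] at hf
    funext i
    rw [key f hf.2 (h0 f hf.2 hf.1.2), apply_symm_apply]
  · intro e he
    simp only [mem_filter, mem_piAntidiag, mem_univ, implies_true, and_true] at he
    funext q
    refine Fin.lastCases ?_ (fun p => ?_) q
    · have := he.1
      rw [← Iic_fin_last, ← Iio_insert, sum_insert (by simp)] at this
      simp only [Fin.lastCases_last, symm_apply_apply]
      omega
    · simp only [Fin.lastCases_castSucc, symm_apply_apply, sum_Iio_succ]
      omega
  · intro f hf
    simp only [mem_filter, Fintype.mem_piFinset, mem_range, ← sorts_iff_sortPerm_eq] at hf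
    have h1 := h0 f hf.2 hf.1.2
    rw [← sum_sum_Iio, total f hf.2 h1 hf.1.1, sum_congr rfl fun q _ => key f hf.2 h1 q,
      ← Equiv.sum_comp σ]
    push_cast
    rfl

/-- The generating function of the compositions of `m` into `N + 1` parts, the part at `q` being
counted `N + 1 - q` times. -/
noncomputable def compositionGF (N m : ℕ) : ℤ[T;T⁻¹] :=
  ∑ e ∈ piAntidiag (univ : Finset (Fin (N + 1))) m,
    T ((∑ q : Fin (N + 1), e q * (N + 1 - (q : ℕ)) : ℕ) : ℤ)

/-- Lowering by one the parts that are forced to be positive leaves an arbitrary composition. -/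
theorem sum_composition_pos {N : ℕ} (E : Finset (Fin (N + 1))) (r : ℕ) :
    (∑ e ∈ piAntidiag (univ : Finset (Fin (N + 1))) r with ∀ q ∈ E, 1 ≤ e q,
        (T ((∑ q : Fin (N + 1), e q * (N + 1 - (q : ℕ)) : ℕ) : ℤ) : ℤ[T;T⁻¹])) =
      if #E ≤ r then T ((∑ q ∈ E, (N + 1 - (q : ℕ)) : ℕ) : ℤ) * compositionGF N (r - #E)
      else 0 := by
  have hE : ∑ q, (if q ∈ E then 1 else 0) = #E := by simp
  split_ifs with h
  · rw [compositionGF, mul_sum]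
    refine sum_nbij' (fun e q => e q - if q ∈ E then 1 else 0)
      (fun e q => e q + if q ∈ E then 1 else 0) ?_ ?_ ?_ ?_ ?_
    · intro e he
      simp only [mem_filter, mem_piAntidiag, mem_univ, implies_true, and_true] at he ⊢
      rw [sum_tsub_distrib _ fun q _ => ?_, he.1, hE]
      split_ifs with hq
      exacts [he.2 q hq, Nat.zero_le _]
    · intro e he
      simp only [mem_filter, mem_piAntidiag, mem_univ, implies_true, and_true] at he ⊢
      refine ⟨?_, fun q hq => by simp [hq]⟩
      rw [sum_add_distrib, he, hE]
      omega
    · intro e he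
      simp only [mem_filter] at he
      funext q
      dsimp only
      split_ifs with hq
      · have := he.2 q hq
        omega
      · rfl
    · intro e _
      funext q
      simp
    · intro e he
      simp only [mem_filter] at he
      rw [← T_add, ← Nat.cast_add]
      congr 2
      rw [← sum_filter_add_sum_filter_not univ (· ∈ E), filter_mem_eq_inter, univ_inter,
        ← sum_filter_add_sum_filter_not univ (· ∈ E) fun q => (e q - _) * _, filter_mem_eq_inter,
        univ_inter, ← add_assoc, ← sum_add_distrib]
      congr 1
      · refine sum_congr rfl fun q hq => ?_
        obtain ⟨a, ha⟩ := Nat.exists_eq_add_of_le (he.2 q hq)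
        simp only [ha, hq, if_true]
        rw [Nat.add_sub_cancel_left]
        ring
      · refine sum_congr rfl fun q hq => ?_
        simp [(mem_filter.1 hq).2]
  · refine sum_eq_zero fun e he => ?_
    simp only [mem_filter, mem_piAntidiag, mem_univ, implies_true, and_true] at he
    refine absurd ?_ h
    rw [← he.1, ← hE]
    refine sum_le_sum fun q _ => ?_
    split_ifs with hq
    exacts [he.2 q hq, Nat.zero_le _]

theorem compositionGF_zero (N : ℕ) : compositionGF N 0 = 1 := by
  simp [compositionGF]

/-! ### Exchanging a greatest letter for a least letter -/

/-- The positions `0, 1, 2, …` are cut into segments, a new segment starting at each element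
of `A`; `segStart A b` is the first position of the segment of `b`. -/
def segStart (A : Finset ℕ) : ℕ → ℕ
  | 0 => 0
  | b + 1 => if b + 1 ∈ A then b + 1 else segStart A b

theorem segStart_le (A : Finset ℕ) (b : ℕ) : segStart A b ≤ b := by
  induction b with
  | zero => simp [segStart]
  | succ b ih => rw [segStart]; split_ifs <;> omega

theorem segStart_eq_zero_or_mem (A : Finset ℕ) (b : ℕ) : segStart A b = 0 ∨ segStart A b ∈ A := by
  induction b with
  | zero => simp [segStart]
  | succ b ih => rw [segStart]; split_ifs with h; exacts [Or.inr h, ih]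

theorem notMem_of_segStart_lt {A : Finset ℕ} {b j : ℕ} (h : segStart A b < j) (hj : j ≤ b) :
    j ∉ A := by
  induction b with
  | zero => omega
  | succ b ih =>
    rw [segStart] at h
    split_ifs at h with hb
    · omega
    · rcases hj.lt_or_eq with h1 | rfl
      exacts [ih h (by omega), hb]

/-- The segment of `i`, cut off at `N`, has an end `b`. -/
theorem exists_segEnd (A : Finset ℕ) {N i : ℕ} (hi : i ≤ N) :
    ∃ b, i ≤ b ∧ b ≤ N ∧ (b = N ∨ b + 1 ∈ A) ∧ segStart A b ≤ i := by
  obtain ⟨k, rfl⟩ := Nat.exists_eq_add_of_le hi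
  clear hi
  induction k generalizing i with
  | zero => exact ⟨i, le_rfl, le_rfl, Or.inl rfl, segStart_le A i⟩
  | succ k ih =>
    by_cases hA : i + 1 ∈ A
    · exact ⟨i, le_rfl, by omega, Or.inr hA, segStart_le A i⟩
    · obtain ⟨b, h1, h2, h3, h4⟩ := ih (i := i + 1)
      have : segStart A b ≠ i + 1 := fun h =>
        (segStart_eq_zero_or_mem A b).elim (fun h0 => by omega) fun h0 => hA (h ▸ h0)
      exact ⟨b, by omega, by omega, h3.imp_left fun h => by omega, by omega⟩

/-- A sequence of letters at the positions `0, …, N` is weakly decreasing on each segment. -/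
def SegAntitone (A : Finset ℕ) (N : ℕ) (C : ℕ → ℕ) : Prop :=
  ∀ j < N, j + 1 ∉ A → C (j + 1) ≤ C j

theorem SegAntitone.le_segStart {A : Finset ℕ} {N : ℕ} {C : ℕ → ℕ} (h : SegAntitone A N C)
    {b i : ℕ} (hb : b ≤ N) (hi : segStart A b ≤ i) (hib : i ≤ b) : C i ≤ C (segStart A b) := by
  induction i, hi using Nat.le_induction with
  | base => exact le_rfl
  | succ i hi ih =>
    exact (h i (by omega) (notMem_of_segStart_lt (by omega) hib)).trans (ih (by omega))

/-- The first letter of the segment ending at `b` is dropped, the letter `0` is appended to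
this segment, and the letters to the right of the segment are raised by one. -/
def rotateUp (A : Finset ℕ) (b : ℕ) (C : ℕ → ℕ) (j : ℕ) : ℕ :=
  if b < j then C j + 1 else if j = b then 0 else if segStart A b ≤ j then C (j + 1) else C j

/-- The last letter of the segment ending at `b` is dropped, the letter `r` is put in front of
this segment, and the letters to the right of the segment are lowered by one. -/
def rotateDown (A : Finset ℕ) (r b : ℕ) (C : ℕ → ℕ) (j : ℕ) : ℕ :=
  if b < j then C j - 1 else if j = segStart A b then r else if segStart A b ≤ j then C (j - 1)
  else C j

section rotate

variable {A : Finset ℕ} {N r b : ℕ} {C : ℕ → ℕ}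

theorem SegAntitone.rotateUp (h : SegAntitone A N C) (hbN : b ≤ N)
    (hb : b = N ∨ b + 1 ∈ A) :
    SegAntitone A N (rotateUp A b C) := by
  intro j hj hA
  have hjb : j ≠ b := by
    rintro rfl
    exact hb.elim (fun h => by omega) hA
  have ha : segStart A b ≠ j + 1 := fun h =>
    (segStart_eq_zero_or_mem A b).elim (fun h0 => by omega) fun h0 => hA (h ▸ h0)
  have h1 := h j hj hA
  have h2 : segStart A b ≤ j → j + 1 < b → C (j + 1 + 1) ≤ C (j + 1) := by
    intro h3 h4
    exact h (j + 1) (by omega) (notMem_of_segStart_lt (b := b) (by omega) (by omega))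
  unfold URGStat.rotateUp
  split_ifs <;> omega

theorem SegAntitone.rotateDown (h : SegAntitone A N C) (hb : b = N ∨ b + 1 ∈ A)
    (hr : ∀ j ≤ N, C j ≤ r) : SegAntitone A N (rotateDown A r b C) := by
  intro j hj hA
  have hjb : j ≠ b := by
    rintro rfl
    exact hb.elim (fun h => by omega) hA
  have ha : segStart A b ≠ j + 1 := fun h =>
    (segStart_eq_zero_or_mem A b).elim (fun h0 => by omega) fun h0 => hA (h ▸ h0)
  have h1 := h j hj hA
  have h2 : segStart A b < j → j < b → C j ≤ C (j - 1) := by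
    intro h3 h4
    obtain ⟨i, rfl⟩ : ∃ i, j = i + 1 := ⟨j - 1, by omega⟩
    exact h i (by omega) (notMem_of_segStart_lt (b := b) (by omega) (by omega))
  have h3 := hr j (by omega)
  unfold URGStat.rotateDown
  rw [Nat.add_sub_cancel]
  split_ifs <;> omega

theorem rotateDown_rotateUp (hr : C (segStart A b) = r) (j : ℕ) :
    rotateDown A r b (rotateUp A b C) j = C j := by
  have := segStart_le A b
  unfold rotateDown rotateUp
  split_ifs <;> first | omega | rfl | skip
  · simp_all
  · congr 1; omega

theorem rotateUp_rotateDown (h0 : C b = 0) (hpos : ∀ j, b < j → j ≤ N → 0 < C j) {j : ℕ}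
    (hj : j ≤ N) : rotateUp A b (rotateDown A r b C) j = C j := by
  have := segStart_le A b
  have := hpos j
  rcases eq_or_ne j b with rfl | hjb
  · simp [rotateUp, h0]
  simp only [rotateUp, rotateDown, Nat.add_sub_cancel]
  split_ifs <;> omega

/-- Rotating loses the letter at the start of the segment and adds one to each letter to the right
of the segment. -/
theorem sum_rotateUp (hbN : b ≤ N) :
    ∑ j ∈ range (N + 1), rotateUp A b C j + C (segStart A b) =
      ∑ j ∈ range (N + 1), C j + (N - b) := by
  have hab := segStart_le A b
  have h1 : ∀ m ≤ segStart A b, ∑ j ∈ range m, rotateUp A b C j = ∑ j ∈ range m, C j := by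
    intro m hm
    refine sum_congr rfl fun j hj => ?_
    have := mem_range.1 hj
    unfold rotateUp
    split_ifs <;> omega
  have h2 : ∀ m, segStart A b ≤ m → m ≤ b →
      ∑ j ∈ range m, rotateUp A b C j + C (segStart A b) = ∑ j ∈ range (m + 1), C j := by
    intro m hm
    induction m, hm using Nat.le_induction with
    | base => intro _; rw [h1 _ le_rfl, sum_range_succ]
    | succ m hm ih =>
      intro h
      rw [sum_range_succ C, ← ih (by omega), sum_range_succ]
      have : rotateUp A b C m = C (m + 1) := by
        unfold rotateUp
        split_ifs <;> omega
      rw [this]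
      ring
  have h3 : ∀ m, b ≤ m → ∑ j ∈ range (m + 1), rotateUp A b C j + C (segStart A b) =
      ∑ j ∈ range (m + 1), C j + (m - b) := by
    intro m hm
    induction m, hm using Nat.le_induction with
    | base => rw [sum_range_succ, ← h2 b hab le_rfl]; simp [rotateUp]
    | succ m hm ih =>
      have : rotateUp A b C (m + 1) = C (m + 1) + 1 := by
        unfold rotateUp
        split_ifs <;> omega
      rw [sum_range_succ, sum_range_succ C, this]
      omega
  exact h3 N hbN

end rotate

/-- The letters of `f` as a function of a natural number; only the values at `j ≤ N` matter. -/
def letterAt {N : ℕ} (f : Fin (N + 1) → ℕ) (j : ℕ) : ℕ := f (Fin.ofNat (N + 1) j)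

theorem letterAt_val {N : ℕ} (f : Fin (N + 1) → ℕ) (i : Fin (N + 1)) : letterAt f i = f i := by
  simp [letterAt]

theorem letterAt_mk {N : ℕ} (g : ℕ → ℕ) {j : ℕ} (hj : j ≤ N) :
    letterAt (fun i : Fin (N + 1) => g i) j = g j := by
  have : j % (N + 1) = j := Nat.mod_eq_of_lt (by omega)
  simp [letterAt, this]

theorem asc_subset_iff_segAntitone {N : ℕ} {f : Fin (N + 1) → ℕ} {A : Finset ℕ} :
    Asc f ⊆ A ↔ SegAntitone A N (letterAt f) := by
  rw [asc_subset_iff_forall]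
  constructor
  · intro h j hj hA
    have := h ⟨j, hj⟩ hA
    rwa [← letterAt_val f, ← letterAt_val f] at this
  · intro h p hA
    have := h p p.2 hA
    rwa [← letterAt_val f, ← letterAt_val f]

/-- The end of the last segment which starts with the letter `r`, cut off at `N`. If no segment
starts with `r`, the value is `0`. -/
def lastTop {N : ℕ} (A : Finset ℕ) (r : ℕ) (f : Fin (N + 1) → ℕ) : ℕ :=
  ((range (N + 1)).filter fun b => (b = N ∨ b + 1 ∈ A) ∧ letterAt f (segStart A b) = r).sup id

theorem lastTop_spec {N : ℕ} {A : Finset ℕ} {r : ℕ} {f : Fin (N + 1) → ℕ} (hf : Asc f ⊆ A)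
    (hr : ∀ i, f i ≤ r) (hmax : ∃ i, f i = r) :
    lastTop A r f ≤ N ∧ (lastTop A r f = N ∨ lastTop A r f + 1 ∈ A) ∧
      letterAt f (segStart A (lastTop A r f)) = r ∧
      ∀ j, lastTop A r f < j → j ≤ N → letterAt f j < r := by
  rw [asc_subset_iff_segAntitone] at hf
  have key : ∀ j ≤ N, letterAt f j = r → ∃ b ∈ (range (N + 1)).filter
      fun b => (b = N ∨ b + 1 ∈ A) ∧ letterAt f (segStart A b) = r, j ≤ b := by
    intro j hj hjr
    obtain ⟨b, h1, h2, h3, h4⟩ := exists_segEnd A hj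
    refine ⟨b, mem_filter.2 ⟨mem_range.2 (by omega), h3, ?_⟩, h1⟩
    have := hf.le_segStart h2 h4 h1
    have : letterAt f (segStart A b) ≤ r := hr _
    omega
  obtain ⟨i, hi⟩ := hmax
  obtain ⟨b, hb, -⟩ := key i (by omega) (by rw [letterAt_val, hi])
  have hmem := exists_mem_eq_sup _ ⟨b, hb⟩ (id : ℕ → ℕ)
  obtain ⟨b', hb', heq⟩ := hmem
  have heq : lastTop A r f = b' := heq
  rw [mem_filter, mem_range, ← heq] at hb'
  refine ⟨by omega, hb'.2.1, hb'.2.2, fun j hj hjN => ?_⟩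
  refine lt_of_le_of_ne (hr _) fun hjr => ?_
  obtain ⟨b, hb, hjb⟩ := key j hjN hjr
  have : b ≤ lastTop A r f := le_sup (f := id) hb
  omega

theorem lastTop_eq {N : ℕ} {A : Finset ℕ} {r b : ℕ} {f : Fin (N + 1) → ℕ} (hbN : b ≤ N)
    (hb : b = N ∨ b + 1 ∈ A) (hr : letterAt f (segStart A b) = r)
    (hlt : ∀ j, b < j → j ≤ N → letterAt f j < r) : lastTop A r f = b := by
  refine le_antisymm (Finset.sup_le fun b' hb' => ?_) (le_sup (f := id) (mem_filter.2
    ⟨mem_range.2 (by omega), hb, hr⟩))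
  rw [mem_filter, mem_range] at hb'
  by_contra h
  have h : b < b' := not_le.1 h
  have hA : b + 1 ∈ A := hb.resolve_left (by omega)
  have h1 : b + 1 ≤ segStart A b' := by
    by_contra h1
    exact notMem_of_segStart_lt (b := b') (not_le.1 h1) (by omega) hA
  exact (hlt _ (by omega) ((segStart_le A b').trans (by omega))).ne hb'.2.2

/-- The sorting permutation starts with the last occurrence of the least letter. -/
theorem sortPerm_zero_eq_iff {N : ℕ} {f : Fin (N + 1) → ℕ} {b : Fin (N + 1)} :
    sortPerm f 0 = b ↔ ∀ i, f b < f i ∨ f b = f i ∧ i ≤ b := by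
  have h : Sorts (sortPerm f) f := sorts_iff_sortPerm_eq.2 rfl
  have h0 : ∀ i, f (sortPerm f 0) < f i ∨ f (sortPerm f 0) = f i ∧ i ≤ sortPerm f 0 := by
    intro i
    rcases (Fin.zero_le ((sortPerm f).symm i)).lt_or_eq with h1 | h1
    · have h2 := h h1
      rw [Function.comp_apply, Function.comp_apply, apply_symm_apply, sortKey_lt] at h2
      exact h2.imp_right fun h3 => ⟨h3.1, h3.2.le⟩
    · rw [h1, apply_symm_apply]
      exact Or.inr ⟨rfl, le_rfl⟩
  constructor
  · rintro rfl
    exact h0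
  · intro hb
    have h1 := h0 b
    have h2 := hb (sortPerm f 0)
    rcases h1 with h1 | h1 <;> rcases h2 with h2 | h2
    · omega
    · omega
    · omega
    · exact le_antisymm h2.2 h1.2

/-- The words with greatest letter `r` correspond to the words with least letter `0` and letters at
most `r`; under `rotateUp`, the sum of the letters drops by `r` and grows by the number of positions
to the right of the last `0`. -/
theorem sum_max_eq_sum_min (N : ℕ) (A : Finset ℕ) (r : ℕ)
    [DecidablePred fun f : Fin (N + 1) → ℕ => Asc f ⊆ A] :
    ∑ f ∈ ((Fintype.piFinset fun _ : Fin (N + 1) => range (r + 1)).filter fun f => ∃ i, f i = r)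
        with Asc f ⊆ A, (T (∑ i, (f i : ℤ)) : ℤ[T;T⁻¹]) =
      ∑ f ∈ ((Fintype.piFinset fun _ : Fin (N + 1) => range (r + 1)).filter fun f => ∃ i, f i = 0)
        with Asc f ⊆ A, T (∑ i, (f i : ℤ) + r + ((sortPerm f 0 : ℕ) - N)) := by
  have hup : ∀ f : Fin (N + 1) → ℕ, Asc f ⊆ A → (∀ i, f i < r + 1) → (∃ i, f i = r) →
      sortPerm (fun i : Fin (N + 1) => rotateUp A (lastTop A r f) (letterAt f) i) 0 =
        Fin.ofNat (N + 1) (lastTop A r f) := by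
    intro f hA hr hmax
    obtain ⟨h1, h2, h3, h4⟩ := lastTop_spec hA (fun i => Nat.lt_succ_iff.1 (hr i)) hmax
    have hmod : lastTop A r f % (N + 1) = lastTop A r f := Nat.mod_eq_of_lt (by omega)
    rw [sortPerm_zero_eq_iff]
    intro i
    simp only [Fin.ofNat, hmod, Fin.le_def]
    by_cases hi : lastTop A r f < i
    · left
      simp [rotateUp, hi]
    · have : rotateUp A (lastTop A r f) (letterAt f) (lastTop A r f) = 0 := by simp [rotateUp]
      omega
  have hzero : ∀ f : Fin (N + 1) → ℕ, Asc f ⊆ A → (∃ i, f i = 0) → f (sortPerm f 0) = 0 ∧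
      (∀ j, (sortPerm f 0 : ℕ) < j → j ≤ N → 0 < letterAt f j) ∧
      ((sortPerm f 0 : ℕ) = N ∨ (sortPerm f 0 : ℕ) + 1 ∈ A) := by
    rintro f hA ⟨i, hi⟩
    have h := sortPerm_zero_eq_iff.1 (rfl : sortPerm f 0 = sortPerm f 0)
    have h0 : f (sortPerm f 0) = 0 := by
      have := h i
      omega
    have hpos : ∀ j, (sortPerm f 0 : ℕ) < j → j ≤ N → 0 < letterAt f j := by
      intro j hj hjN
      have hmod : j % (N + 1) = j := Nat.mod_eq_of_lt (by omega)
      have h1 : f (sortPerm f 0) < letterAt f j ∨ f (sortPerm f 0) = letterAt f j ∧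
        j % (N + 1) ≤ sortPerm f 0 := h (Fin.ofNat (N + 1) j)
      omega
    refine ⟨h0, hpos, ?_⟩
    by_contra hcon
    rw [not_or] at hcon
    have h1 : (sortPerm f 0 : ℕ) < N := by omega
    -- Inside a segment, a letter to the right of a `0` is again `0`.
    have h2 := asc_subset_iff_segAntitone.1 hA _ h1 hcon.2
    have h3 := hpos ((sortPerm f 0 : ℕ) + 1) (by omega) (by omega)
    rw [letterAt_val, h0] at h2
    omega
  refine sum_nbij' (fun f i => rotateUp A (lastTop A r f) (letterAt f) i)
    (fun f i => rotateDown A r (sortPerm f 0) (letterAt f) i) ?_ ?_ ?_ ?_ ?_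
  · intro f hf
    simp only [mem_filter, Fintype.mem_piFinset, mem_range] at hf ⊢
    obtain ⟨⟨hr, hmax⟩, hA⟩ := hf
    obtain ⟨h1, h2, h3, h4⟩ := lastTop_spec hA (fun i => Nat.lt_succ_iff.1 (hr i)) hmax
    refine ⟨⟨fun i => ?_, ⟨lastTop A r f, by omega⟩, by simp [rotateUp]⟩, ?_⟩
    · have h5 := h4 i
      have h6 : ∀ j, letterAt f j < r + 1 := fun j => hr _
      have h7 := h6 i
      have h8 := h6 (i + 1)
      unfold rotateUp
      split_ifs <;> omega
    · rw [asc_subset_iff_segAntitone] at hA ⊢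
      intro j hj hjA
      rw [letterAt_mk _ (by omega), letterAt_mk _ (by omega)]
      exact hA.rotateUp h1 h2 j hj hjA
  · intro f hf
    simp only [mem_filter, Fintype.mem_piFinset, mem_range] at hf ⊢
    obtain ⟨⟨hr, hmin⟩, hA⟩ := hf
    obtain ⟨h0, hpos, hend⟩ := hzero f hA hmin
    have ha := segStart_le A (sortPerm f 0)
    have h6 : ∀ j, letterAt f j < r + 1 := fun j => hr _
    refine ⟨⟨fun i => ?_, ⟨segStart A (sortPerm f 0), by omega⟩, ?_⟩, ?_⟩
    · have h7 := h6 i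
      have h8 := h6 (i - 1)
      unfold rotateDown
      split_ifs <;> omega
    · change rotateDown A r (sortPerm f 0) (letterAt f) (segStart A (sortPerm f 0)) = r
      rw [rotateDown, if_neg (by omega), if_pos rfl]
    · rw [asc_subset_iff_segAntitone] at hA ⊢
      intro j hj hjA
      rw [letterAt_mk _ (by omega), letterAt_mk _ (by omega)]
      exact hA.rotateDown hend (fun j _ => Nat.lt_succ_iff.1 (h6 j)) j hj hjA
  · intro f hf
    simp only [mem_filter, Fintype.mem_piFinset, mem_range] at hf
    obtain ⟨⟨hr, hmax⟩, hA⟩ := hf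
    obtain ⟨h1, h2, h3, h4⟩ := lastTop_spec hA (fun i => Nat.lt_succ_iff.1 (hr i)) hmax
    have hmod : lastTop A r f % (N + 1) = lastTop A r f := Nat.mod_eq_of_lt (by omega)
    funext i
    rw [hup f hA hr hmax]
    simp only [Fin.ofNat, hmod]
    rw [← letterAt_val f, ← rotateDown_rotateUp h3 i]
    have := segStart_le A (lastTop A r f)
    unfold rotateDown
    split_ifs <;> first | rfl | rw [letterAt_mk _ (by omega)]
  · intro f hf
    simp only [mem_filter, Fintype.mem_piFinset, mem_range] at hf
    obtain ⟨⟨hr, hmin⟩, hA⟩ := hf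
    obtain ⟨h0, hpos, hend⟩ := hzero f hA hmin
    have ha := segStart_le A (sortPerm f 0)
    have h6 : ∀ j, letterAt f j < r + 1 := fun j => hr _
    have htop : lastTop A r
        (fun i : Fin (N + 1) => rotateDown A r (sortPerm f 0) (letterAt f) i) = sortPerm f 0 := by
      refine lastTop_eq (by omega) hend ?_ fun j hj hjN => ?_
      · rw [letterAt_mk _ (by omega), rotateDown, if_neg (by omega), if_pos rfl]
      · rw [letterAt_mk _ hjN, rotateDown, if_pos hj]
        have := hpos j hj hjN
        have := h6 j
        omega
    funext i
    rw [htop, ← letterAt_val f, ← rotateUp_rotateDown (A := A) (r := r)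
      (by rw [letterAt_val, h0]) hpos (show (i : ℕ) ≤ N by omega)]
    unfold rotateUp
    split_ifs <;> first | rfl | rw [letterAt_mk _ (by omega)]
  · intro f hf
    simp only [mem_filter, Fintype.mem_piFinset, mem_range] at hf
    obtain ⟨⟨hr, hmax⟩, hA⟩ := hf
    obtain ⟨h1, h2, h3, h4⟩ := lastTop_spec hA (fun i => Nat.lt_succ_iff.1 (hr i)) hmax
    have hmod : lastTop A r f % (N + 1) = lastTop A r f := Nat.mod_eq_of_lt (by omega)
    rw [hup f hA hr hmax]
    simp only [Fin.ofNat, hmod]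
    congr 1
    have h5 := sum_rotateUp (A := A) (C := letterAt f) h1
    rw [h3, ← Fin.sum_univ_eq_sum_range, ← Fin.sum_univ_eq_sum_range] at h5
    simp only [letterAt_val] at h5
    zify [h1] at h5
    linarith

/-! ### Equidistribution on classes of permutations -/

/-- `H` is invertible as a power series, so it can be cancelled from a convolution. -/
theorem sum_fiber_eq_of_convolution_eq {ι R : Type*} [CommRing R] (S : Finset ι) (d : ι → ℕ)
    (X Y : ι → R) (H : ℕ → R) (hH : H 0 = 1)
    (h : ∀ r, ∑ s ∈ S, X s * (if d s ≤ r then H (r - d s) else 0) =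
      ∑ s ∈ S, Y s * (if d s ≤ r then H (r - d s) else 0)) (j : ℕ) :
    ∑ s ∈ S with d s = j, X s = ∑ s ∈ S with d s = j, Y s := by
  have conv : ∀ (Z : ι → R) (r : ℕ), ∑ s ∈ S, Z s * (if d s ≤ r then H (r - d s) else 0) =
      ∑ i ∈ range (r + 1), (∑ s ∈ S with d s = i, Z s) * H (r - i) := by
    intro Z r
    simp_rw [mul_ite, mul_zero, ← sum_filter]
    rw [← sum_fiberwise_of_maps_to (g := d) (t := range (r + 1))
      (fun s hs => mem_range.2 (Nat.lt_succ_of_le (mem_filter.1 hs).2))]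
    refine sum_congr rfl fun i hi => ?_
    rw [filter_filter, sum_mul]
    refine sum_congr (filter_congr fun s _ => ?_) fun s hs => by rw [(mem_filter.1 hs).2]
    have := mem_range.1 hi
    exact ⟨fun h => h.2, fun h => ⟨by omega, h⟩⟩
  induction j using Nat.strong_induction_on with
  | _ j ih =>
    have hj := h j
    rw [conv, conv, sum_range_succ, sum_range_succ, Nat.sub_self, hH, mul_one, mul_one,
      sum_congr rfl fun i hi => by rw [ih i (mem_range.1 hi)]] at hj
    exact add_left_cancel hj

/-- The sum, over the ascents of `σ`, of the number of entries to the right of the ascent. -/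
def comaj {N : ℕ} (σ : Perm (Fin (N + 1))) : ℕ := ∑ p ∈ ascents σ, (N - (p : ℕ))

/-- Both sides are sums over words with ascents in `A`: those with greatest letter `r` on the left,
those with least letter `0` and letters at most `r` on the right. -/
theorem sum_permClass_mul_compositionGF (N : ℕ) (A : Finset ℕ) (r : ℕ) :
    ∑ σ ∈ permClass N A, (T (comaj σ : ℤ) : ℤ[T;T⁻¹]) *
        (if #(ascents σ) ≤ r then compositionGF N (r - #(ascents σ)) else 0) =
      ∑ σ ∈ permClass N A, T (comaj σ + (#(ascents σ) + (σ 0 : ℕ) - N : ℤ)) *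
        (if #(ascents σ) ≤ r then compositionGF N (r - #(ascents σ)) else 0) := by
  classical
  have h := sum_max_eq_sum_min N A r
  rw [sum_eq_sum_permClass, sum_eq_sum_permClass] at h
  convert h using 2 with σ _ σ _
  · have h1 := sum_composition_pos ((ascents σ).map (Fin.succEmb N)) r
    simp only [forall_mem_map, card_map, sum_map] at h1
    rw [sum_sorted_max_eq]
    simp only [Fin.coe_succEmb] at h1
    refine Eq.trans ?_ (h1.symm.trans (by congr!))
    simp [comaj]
  · have h1 := sum_composition_pos ((ascents σ).map Fin.castSuccEmb) r
    simp only [forall_mem_map, card_map, sum_map] at h1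
    simp only [Fin.coe_castSuccEmb] at h1
    rw [sum_congr rfl fun f hf => by rw [(mem_filter.1 hf).2, T_add], ← sum_mul,
      sum_sorted_min_eq]
    refine Eq.trans ?_ (congrArg (· * _) (h1.symm.trans (by congr!)))
    -- The gap `p` is indexed by `p.castSucc` here and by `p.succ` above, so each forced part weighs
    -- one more than in `comaj σ`.
    have h2 : ∑ p ∈ ascents σ, (N + 1 - (p.castSucc : ℕ)) = comaj σ + #(ascents σ) := by
      rw [comaj, card_eq_sum_ones, ← sum_add_distrib]
      refine sum_congr rfl fun p _ => ?_
      have := p.2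
      simp only [Fin.val_castSucc]
      omega
    rw [h2]
    split_ifs
    · rw [mul_right_comm, ← T_add]
      congr 2
      push_cast
      ring
    · simp

/-- On each class of permutations, `comaj σ` and `comaj σ + asc σ + σ 0 - N` are equidistributed,
jointly with the number of ascents. -/
theorem sum_permClass_comaj_eq (N : ℕ) (A : Finset ℕ) (K : ℕ → ℤ[T;T⁻¹]) :
    ∑ σ ∈ permClass N A, T (comaj σ : ℤ) * K #(ascents σ) =
      ∑ σ ∈ permClass N A, T (comaj σ + (#(ascents σ) + (σ 0 : ℕ) - N : ℤ)) * K #(ascents σ) := by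
  have h := sum_fiber_eq_of_convolution_eq (permClass N A) (fun σ => #(ascents σ)) _ _
    (compositionGF N) (compositionGF_zero N) (sum_permClass_mul_compositionGF N A)
  have key : ∀ Z : Perm (Fin (N + 1)) → ℤ[T;T⁻¹], ∑ σ ∈ permClass N A, Z σ * K #(ascents σ) =
      ∑ j ∈ range (N + 1), (∑ σ ∈ permClass N A with #(ascents σ) = j, Z σ) * K j := by
    intro Z
    rw [← sum_fiberwise_of_maps_to (g := fun σ => #(ascents σ)) (t := range (N + 1))
      (fun σ _ => mem_range.2 (Nat.lt_succ_of_le (card_finset_fin_le _)))]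
    refine sum_congr rfl fun j _ => ?_
    rw [sum_mul]
    exact sum_congr rfl fun σ hσ => by rw [(mem_filter.1 hσ).2]
  rw [key, key]
  exact sum_congr rfl fun j _ => by rw [h j]

/-! ### Unrestricted growth functions as permutations with bars -/

section bars

variable {N k : ℕ} {w : Fin (N + 1) → ℕ} {σ : Perm (Fin (N + 1))}

/-- The bars that separate the blocks of `w`, when the positions are listed in the order `σ`. -/
def bars (σ : Perm (Fin (N + 1))) (w : Fin (N + 1) → ℕ) : Finset (Fin N) :=
  univ.filter fun p => w (σ p.castSucc) < w (σ p.succ)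

theorem mem_bars {p : Fin N} : p ∈ bars σ w ↔ w (σ p.castSucc) < w (σ p.succ) := by simp [bars]

theorem Sorts.ascents_subset_bars (h : Sorts σ w) : ascents σ ⊆ bars σ w :=
  fun p hp => mem_bars.2 ((sorts_iff.1 h p).2 hp)

theorem mem_URG_iff : w ∈ URG (N + 1) k ↔
    (∀ i, 1 ≤ w i ∧ w i ≤ k) ∧ ∀ j, 1 ≤ j → j ≤ k → ∃ i, w i = j := by
  rw [mem_URG, IsURG, bk]
  constructor
  · rintro ⟨⟨h1, h2⟩, rfl⟩
    exact ⟨fun i => ⟨h1 i, le_sup (mem_univ i)⟩, fun j hj hj' => h2 j (mem_Icc.2 ⟨hj, hj'⟩)⟩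
  · rintro ⟨h1, h2⟩
    have hk : univ.sup w = k := by
      refine le_antisymm (Finset.sup_le fun i _ => (h1 i).2) ?_
      have h3 := h1 0
      obtain ⟨i, rfl⟩ := h2 k (by omega) le_rfl
      exact le_sup (mem_univ i)
    exact ⟨⟨fun i => (h1 i).1, fun j hj => h2 j (mem_Icc.1 hj).1 (hk ▸ (mem_Icc.1 hj).2)⟩, hk⟩

/-- Every letter up to `k` occurs, so consecutive letters in sorted order differ by at most one. -/
theorem apply_succ_le (hw : w ∈ URG (N + 1) k) (h : Sorts σ w) (p : Fin N) :
    w (σ p.succ) ≤ w (σ p.castSucc) + 1 := by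
  rw [mem_URG_iff] at hw
  by_contra hlt
  obtain ⟨i, hi⟩ := hw.2 (w (σ p.castSucc) + 1) (by omega) (by have := hw.1 (σ p.succ); omega)
  obtain ⟨q, rfl⟩ := σ.surjective i
  rcases le_or_gt q p.castSucc with hq | hq
  · have := h.monotone hq
    simp only [Function.comp_apply] at this
    omega
  · have := h.monotone (Fin.castSucc_lt_iff_succ_le.1 hq)
    simp only [Function.comp_apply] at this
    omega

theorem apply_succ_eq (hw : w ∈ URG (N + 1) k) (h : Sorts σ w) (p : Fin N) :
    w (σ p.succ) = w (σ p.castSucc) + if p ∈ bars σ w then 1 else 0 := by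
  have h1 := apply_succ_le hw h p
  have h2 := (sorts_iff.1 h p).1
  have h3 := mem_bars (σ := σ) (w := w) (p := p)
  split_ifs with h4
  · have := h3.1 h4
    omega
  · have := mt h3.2 h4
    omega

theorem apply_zero_eq_one (hw : w ∈ URG (N + 1) k) (h : Sorts σ w) : w (σ 0) = 1 := by
  rw [mem_URG_iff] at hw
  have h1 := hw.1 (σ 0)
  obtain ⟨i, hi⟩ := hw.2 1 le_rfl (by omega)
  have h2 := h.monotone (Fin.zero_le (σ.symm i))
  simp only [Function.comp_apply, apply_symm_apply] at h2
  omega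

theorem apply_last_eq (hw : w ∈ URG (N + 1) k) (h : Sorts σ w) : w (σ (Fin.last N)) = k := by
  rw [mem_URG_iff] at hw
  have h1 := hw.1 (σ (Fin.last N))
  obtain ⟨i, hi⟩ := hw.2 k (by omega) le_rfl
  have h2 := h.monotone (Fin.le_last (σ.symm i))
  simp only [Function.comp_apply, apply_symm_apply] at h2
  omega

/-- The number of bars of `B` to the left of the entry `q`. -/
def barsBefore (B : Finset (Fin N)) (q : Fin (N + 1)) : ℕ := #{b ∈ B | b.castSucc < q}

theorem barsBefore_zero (B : Finset (Fin N)) : barsBefore B 0 = 0 := by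
  simp [barsBefore]

theorem barsBefore_last (B : Finset (Fin N)) : barsBefore B (Fin.last N) = #B := by
  simp [barsBefore, Fin.castSucc_lt_last]

theorem barsBefore_succ (B : Finset (Fin N)) (p : Fin N) :
    barsBefore B p.succ = barsBefore B p.castSucc + if p ∈ B then 1 else 0 := by
  have h : {b ∈ B | b.castSucc < p.succ} = {b ∈ B | b.castSucc < p.castSucc} ∪ {b ∈ B | b = p} := by
    ext b
    simp only [mem_filter, mem_union, Fin.lt_def, Fin.ext_iff, Fin.val_succ, Fin.val_castSucc,
      ← and_or_left, Nat.lt_succ_iff_lt_or_eq]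
  rw [barsBefore, h, card_union_of_disjoint, ← barsBefore, filter_eq']
  · split_ifs <;> simp
  · rw [disjoint_left]
    intro b hb hb'
    simp only [mem_filter] at hb hb'
    exact hb.2.ne (by rw [hb'.2])

theorem apply_eq_barsBefore (hw : w ∈ URG (N + 1) k) (h : Sorts σ w) (q : Fin (N + 1)) :
    w (σ q) = 1 + barsBefore (bars σ w) q := by
  induction q using Fin.induction with
  | zero => rw [apply_zero_eq_one hw h, barsBefore_zero]
  | succ p ih => rw [apply_succ_eq hw h, ih, barsBefore_succ, add_assoc]

theorem card_bars (hw : w ∈ URG (N + 1) k) (h : Sorts σ w) : #(bars σ w) + 1 = k := by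
  rw [← apply_last_eq hw h, apply_eq_barsBefore hw h, barsBefore_last, add_comm]

/-- The word sorted by `σ` whose blocks are separated by the bars `B`. -/
def wordOfBars (σ : Perm (Fin (N + 1))) (B : Finset (Fin N)) (i : Fin (N + 1)) : ℕ :=
  1 + barsBefore B (σ.symm i)

theorem wordOfBars_apply (B : Finset (Fin N)) (q : Fin (N + 1)) :
    wordOfBars σ B (σ q) = 1 + barsBefore B q := by
  rw [wordOfBars, symm_apply_apply]

theorem sorts_wordOfBars {B : Finset (Fin N)} (hB : ascents σ ⊆ B) : Sorts σ (wordOfBars σ B) := by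
  rw [sorts_iff]
  intro p
  rw [wordOfBars_apply, wordOfBars_apply, barsBefore_succ]
  refine ⟨by omega, fun hp => ?_⟩
  rw [if_pos (hB hp)]
  omega

theorem bars_wordOfBars (B : Finset (Fin N)) : bars σ (wordOfBars σ B) = B := by
  ext p
  rw [mem_bars, wordOfBars_apply, wordOfBars_apply, barsBefore_succ]
  split_ifs with h <;> simp [h]

theorem wordOfBars_mem_URG (B : Finset (Fin N)) : wordOfBars σ B ∈ URG (N + 1) (#B + 1) := by
  rw [mem_URG_iff]
  refine ⟨fun i => ⟨Nat.le_add_right _ _, ?_⟩, fun j h1 hj => ?_⟩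
  · have : barsBefore B (σ.symm i) ≤ #B := card_filter_le _ _
    rw [wordOfBars]
    omega
  · have key : ∀ q : Fin (N + 1), j ≤ barsBefore B q + 1 → ∃ i, wordOfBars σ B i = j := by
      intro q
      induction q using Fin.induction with
      | zero =>
        intro h
        rw [barsBefore_zero] at h
        exact ⟨σ 0, by rw [wordOfBars_apply, barsBefore_zero]; omega⟩
      | succ p ih =>
        intro h
        rcases h.lt_or_eq with h2 | h2
        · rw [barsBefore_succ] at h2
          exact ih (by split_ifs at h2 <;> omega)
        · exact ⟨σ p.succ, by rw [wordOfBars_apply]; omega⟩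
    exact key (Fin.last N) (by rwa [barsBefore_last])

/-- A sum over the words sorted by `σ` as a sum over the sets of bars that contain the ascents. -/
theorem sum_URG_sorted (σ : Perm (Fin (N + 1))) (hk : 1 ≤ k) (F : (Fin (N + 1) → ℕ) → ℤ[T;T⁻¹])
    (G : Finset (Fin N) → ℤ[T;T⁻¹])
    (hFG : ∀ w ∈ URG (N + 1) k, Sorts σ w → F w = G (bars σ w)) :
    ∑ w ∈ URG (N + 1) k with sortPerm w = σ, F w =
      ∑ B ∈ powersetCard (k - 1) univ with ascents σ ⊆ B, G B := by
  refine sum_nbij' (bars σ) (wordOfBars σ) ?_ ?_ ?_ ?_ ?_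
  · intro w hw
    rw [mem_filter, ← sorts_iff_sortPerm_eq] at hw
    have := card_bars hw.1 hw.2
    exact mem_filter.2 ⟨mem_powersetCard.2 ⟨subset_univ _, by omega⟩, hw.2.ascents_subset_bars⟩
  · intro B hB
    rw [mem_filter, mem_powersetCard] at hB
    rw [mem_filter, ← sorts_iff_sortPerm_eq]
    have h1 := wordOfBars_mem_URG (σ := σ) B
    rw [hB.1.2, Nat.sub_add_cancel hk] at h1
    exact ⟨h1, sorts_wordOfBars hB.2⟩
  · intro w hw
    rw [mem_filter, ← sorts_iff_sortPerm_eq] at hw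
    funext i
    rw [wordOfBars, ← apply_eq_barsBefore hw.1 hw.2, apply_symm_apply]
  · intro B _
    exact bars_wordOfBars B
  · intro w hw
    rw [mem_filter, ← sorts_iff_sortPerm_eq] at hw
    exact hFG w hw.1 hw.2

/-- The letter `i` lies entirely to the right of the letter `i + 1` exactly if the bar between the
two blocks is at a descent of `σ`. -/
theorem succeeds_iff (hw : w ∈ URG (N + 1) k) (h : Sorts σ w) (i : ℕ) :
    Succeeds w i (i + 1) ↔ ∃ p ∈ bars σ w \ ascents σ, w (σ p.castSucc) = i := by
  constructor
  · rintro ⟨i₀, hi₀, j₀, hj₀, rfl, hj, hlt⟩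
    rw [L, mem_filter] at hi₀
    rw [R, mem_filter] at hj₀
    obtain ⟨u, rfl⟩ := σ.surjective i₀
    obtain ⟨v, rfl⟩ := σ.surjective j₀
    have huv : u < v := by
      by_contra huv
      have := h.monotone (not_lt.1 huv)
      simp only [Function.comp_apply] at this
      omega
    obtain ⟨p, rfl⟩ : ∃ p : Fin N, p.castSucc = u :=
      Fin.exists_castSucc_eq.2 (huv.trans_le (Fin.le_last v)).ne
    have h1 : w (σ p.castSucc) < w (σ p.succ) := by
      have h2 := h (Fin.castSucc_lt_succ (i := p))
      rw [Function.comp_apply, Function.comp_apply, sortKey_lt] at h2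
      refine h2.resolve_right fun h3 => ?_
      exact (hi₀.2 _ h3.1.symm).not_gt h3.2
    have h2 := h.monotone (Fin.castSucc_lt_iff_succ_le.1 huv)
    simp only [Function.comp_apply] at h2
    have h3 := hj₀.2 (σ p.succ) (by omega)
    refine ⟨p, mem_sdiff.2 ⟨mem_bars.2 h1, fun h4 => ?_⟩, rfl⟩
    exact (h3.trans_lt hlt).not_gt (mem_ascents.1 h4)
  · rintro ⟨p, hp, rfl⟩
    rw [mem_sdiff] at hp
    have h1 := apply_succ_eq hw h p
    rw [if_pos hp.1] at h1
    have key : ∀ q q', w (σ q) = w (σ q') → q ≤ q' → σ q' ≤ σ q := by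
      intro q q' hq hle
      rcases hle.lt_or_eq with h2 | rfl
      · have h3 := h h2
        rw [Function.comp_apply, Function.comp_apply, sortKey_lt] at h3
        exact (h3.resolve_left hq.not_lt).2.le
      · exact le_rfl
    refine ⟨σ p.castSucc, ?_, σ p.succ, ?_, rfl, h1, ?_⟩
    · rw [L, mem_filter, and_iff_right (mem_univ _)]
      intro j hj
      obtain ⟨q, rfl⟩ := σ.surjective j
      refine key _ _ hj ?_
      by_contra hq
      have := h.monotone (Fin.castSucc_lt_iff_succ_le.1 (not_le.1 hq))
      simp only [Function.comp_apply] at this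
      omega
    · rw [R, mem_filter, and_iff_right (mem_univ _)]
      intro j hj
      obtain ⟨q, rfl⟩ := σ.surjective j
      refine key _ _ hj.symm ?_
      by_contra hq
      have hq : q ≤ p.castSucc := by
        rw [Fin.le_castSucc_iff]
        exact not_le.1 hq
      have := h.monotone hq
      simp only [Function.comp_apply] at this
      omega
    · have := mt mem_ascents.2 hp.2
      exact lt_of_le_of_ne (not_lt.1 this)
        (σ.injective.ne (Fin.castSucc_lt_succ (i := p)).ne')

/-- Distinct bars have distinct letters on their left, so sums over the pairs `i ≻ i + 1` are sums
over the bars that are not at ascents. -/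
theorem sum_succeeds (hw : w ∈ URG (N + 1) k) (h : Sorts σ w) (g : ℕ → ℤ) :
    ∑ i ∈ Icc 1 (bk w), (if Succeeds w i (i + 1) then g i else 0) =
      ∑ p ∈ bars σ w \ ascents σ, g (w (σ p.castSucc)) := by
  rw [← sum_filter]
  have himage : (Icc 1 (bk w)).filter (fun i => Succeeds w i (i + 1)) =
      (bars σ w \ ascents σ).image fun p => w (σ p.castSucc) := by
    ext i
    rw [mem_filter, mem_image, succeeds_iff hw h, and_iff_right_of_imp]
    rintro ⟨p, -, rfl⟩
    rw [mem_Icc, (mem_URG.1 hw).2]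
    exact (mem_URG_iff.1 hw).1 _
  rw [himage, sum_image]
  intro p hp q hq hpq
  have key : ∀ p q : Fin N, p ∈ bars σ w → p < q → w (σ p.castSucc) < w (σ q.castSucc) := by
    intro p q hp hlt
    have h1 : p.succ ≤ q.castSucc := by
      rw [Fin.le_def, Fin.val_succ, Fin.val_castSucc]
      exact hlt
    exact (mem_bars.1 hp).trans_le (h.monotone h1)
  simp only [coe_sdiff, Set.mem_sdiff, mem_coe] at hp hq
  rcases lt_trichotomy p q with h1 | h1 | h1
  · exact absurd hpq (key p q hp.1 h1).ne
  · exact h1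
  · exact absurd hpq (key q p hq.1 h1).ne'

theorem sum_barsBefore (B : Finset (Fin N)) : ∑ q, barsBefore B q = ∑ b ∈ B, (N - (b : ℕ)) := by
  simp only [barsBefore, card_eq_sum_ones, sum_filter]
  rw [sum_comm]
  refine sum_congr rfl fun b _ => ?_
  rw [← sum_filter, ← card_eq_sum_ones]
  have : univ.filter (fun q : Fin (N + 1) => b.castSucc < q) = Ioi b.castSucc := by ext; simp
  rw [this, Fin.card_Ioi]
  simp

/-! ### The statistics in terms of the bars -/

/-- The part of `bmajMIL` contributed by the bars which are not forced by ascents. -/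
def freeWeight (D B : Finset (Fin N)) : ℕ :=
  ∑ p ∈ B \ D, (N - (p : ℕ) + (1 + barsBefore B p.castSucc))

/-- A bar at `p` raises the `N - p` letters to its right by one, and contributes to `bMAJ` exactly
if it is not at an ascent, namely the letter on its left. -/
theorem bmajMIL_eq (hw : w ∈ URG (N + 1) k) (h : Sorts σ w) :
    bmajMIL w = comaj σ + freeWeight (ascents σ) (bars σ w) := by
  have h1 : MIL w = (∑ b ∈ bars σ w, (N - (b : ℕ)) : ℕ) := by
    rw [← sum_barsBefore, MIL, ← Equiv.sum_comp σ, Nat.cast_sum]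
    refine sum_congr rfl fun q _ => ?_
    rw [apply_eq_barsBefore hw h]
    push_cast
    ring
  rw [bmajMIL, bMAJ, sum_succeeds hw h (fun i => (i : ℤ)), h1,
    ← sum_sdiff h.ascents_subset_bars, comaj, freeWeight, sum_add_distrib]
  simp only [apply_eq_barsBefore hw h]
  push_cast
  ring

theorem pro_eq (hw : w ∈ URG (N + 1) k) (h : Sorts σ w) : pro w = (σ 0 : ℕ) + 1 := by
  have h0 := apply_zero_eq_one hw h
  have h1 := sortPerm_zero_eq_iff.1 (congrArg (· 0) (sorts_iff_sortPerm_eq.1 h))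
  refine le_antisymm (Finset.sup_le fun i hi => ?_)
    (le_sup (f := fun i : Fin (N + 1) => (i : ℕ) + 1) (by simp [h0]))
  have h2 := h1 i
  rw [h0, (mem_filter.1 hi).2, Fin.le_def] at h2
  omega

/-- The block nondescents are the bars at ascents, and the last `1` is at position `σ 0 + 1`. -/
theorem bmajBAST_eq (hw : w ∈ URG (N + 1) k) (h : Sorts σ w) :
    bmajBAST w = bmajMIL w + (#(ascents σ) + (σ 0 : ℕ) - N) := by
  have h1 := sum_succeeds hw h fun _ => 1
  have h2 := card_sdiff_add_card_eq_card h.ascents_subset_bars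
  have h3 := card_bars hw h
  rw [bmajBAST, bndes, h1, pro_eq hw h, (mem_URG.1 hw).2, sum_const, nsmul_one]
  push_cast
  omega

/-! ### Choosing the free bars -/

/-- The generating function of the `c`-subsets of the `u` places where a bar may or may not be put,
in a word with `N` places for bars. -/
noncomputable def freeBarsGF (N u c : ℕ) : ℤ[T;T⁻¹] :=
  ∑ S ∈ powersetCard c (univ : Finset (Fin u)),
    T (∑ t ∈ S, ((N : ℤ) + 1 - (t : ℕ) + #{s ∈ S | s < t}))

/-- The contribution of the free bars depends on the number of forced bars only: the number of
places to the left of a place, minus the number of forced bars there, is the number of free places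
there. -/
theorem sum_freeWeight (D : Finset (Fin N)) (c : ℕ) :
    ∑ B ∈ powersetCard c univ with D ⊆ B, (T (freeWeight D B : ℤ) : ℤ[T;T⁻¹]) =
      if #D ≤ c then freeBarsGF N (N - #D) (c - #D) else 0 := by
  split_ifs with hD
  · have hcard : #Dᶜ = N - #D := by rw [card_compl, Fintype.card_fin]
    -- `e` numbers the free places from left to right.
    let e := Dᶜ.orderEmbOfFin hcard
    have hnot : ∀ t, e t ∉ D := fun t => mem_compl.1 (orderEmbOfFin_mem _ _ _)
    have hrange : ∀ p, p ∉ D → ∃ t, e t = p := by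
      intro p hp
      have : p ∈ Set.range e := by
        rw [range_orderEmbOfFin]
        simpa using hp
      exact this
    have hdisj : ∀ S : Finset (Fin (N - #D)), Disjoint D (S.map e.toEmbedding) := by
      intro S
      rw [disjoint_right]
      intro p hp
      obtain ⟨t, -, rfl⟩ := mem_map.1 hp
      exact hnot t
    symm
    refine sum_nbij' (fun S => D ∪ S.map e.toEmbedding) (fun B => univ.filter fun t => e t ∈ B)
      ?_ ?_ ?_ ?_ ?_
    · intro S hS
      rw [mem_powersetCard] at hS
      rw [mem_filter, mem_powersetCard, card_union_of_disjoint (hdisj S), card_map, hS.2]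
      exact ⟨⟨subset_univ _, by omega⟩, subset_union_left⟩
    · intro B hB
      rw [mem_filter, mem_powersetCard] at hB
      rw [mem_powersetCard]
      refine ⟨subset_univ _, ?_⟩
      have h1 : (univ.filter fun t => e t ∈ B).map e.toEmbedding = B \ D := by
        ext p
        rw [mem_map, mem_sdiff]
        constructor
        · rintro ⟨t, ht, rfl⟩
          exact ⟨(mem_filter.1 ht).2, hnot t⟩
        · rintro ⟨hp, hp'⟩
          obtain ⟨t, rfl⟩ := hrange p hp'
          exact ⟨t, mem_filter.2 ⟨mem_univ _, hp⟩, rfl⟩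
      rw [← card_map e.toEmbedding, h1, card_sdiff_of_subset hB.2, hB.1.2]
    · intro S _
      ext t
      simp [hnot]
    · intro B hB
      rw [mem_filter] at hB
      ext p
      rw [mem_union, mem_map]
      constructor
      · rintro (hp | ⟨t, ht, rfl⟩)
        exacts [hB.2 hp, (mem_filter.1 ht).2]
      · intro hp
        by_cases hpD : p ∈ D
        · exact Or.inl hpD
        · obtain ⟨t, rfl⟩ := hrange p hpD
          exact Or.inr ⟨t, mem_filter.2 ⟨mem_univ _, hp⟩, rfl⟩
    · intro S _
      have h1 : (D ∪ S.map e.toEmbedding) \ D = S.map e.toEmbedding := by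
        rw [union_sdiff_left, sdiff_eq_self_of_disjoint (hdisj S).symm]
      rw [freeWeight, h1, sum_map, Nat.cast_sum]
      congr 1
      refine sum_congr rfl fun t _ => ?_
      have h2 : barsBefore (D ∪ S.map e.toEmbedding) (e t).castSucc =
          #{b ∈ D | b < e t} + #{s ∈ S | s < t} := by
        simp only [barsBefore, Fin.castSucc_lt_castSucc_iff]
        rw [filter_union, card_union_of_disjoint (disjoint_filter_filter (hdisj S)), filter_map,
          card_map]
        simp
      have h3 : #{b ∈ D | b < e t} + (t : ℕ) = (e t : ℕ) := by
        have h4 : #{b ∈ Dᶜ | b < e t} = (t : ℕ) := by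
          have h5 : {b ∈ Dᶜ | b < e t} = (Iio t).map e.toEmbedding := by
            ext p
            rw [mem_filter, mem_map, mem_compl]
            constructor
            · rintro ⟨hp, hlt⟩
              obtain ⟨s, rfl⟩ := hrange p hp
              exact ⟨s, mem_Iio.2 (e.lt_iff_lt.1 hlt), rfl⟩
            · rintro ⟨s, hs, rfl⟩
              exact ⟨hnot s, e.lt_iff_lt.2 (mem_Iio.1 hs)⟩
          rw [h5, card_map, Fin.card_Iio]
        rw [← h4, ← card_union_of_disjoint (disjoint_filter_filter disjoint_compl_right),
          ← filter_union, union_compl, ← Fin.card_Iio (e t)]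
        congr 1
        ext
        simp
      have h6 := (e t).2
      change _ = ((N - (e t : ℕ) +
        (1 + barsBefore (D ∪ S.map e.toEmbedding) (e t).castSucc) : ℕ) : ℤ)
      rw [h2]
      push_cast [h6.le]
      omega
  · refine sum_eq_zero fun B hB => absurd ?_ hD
    rw [mem_filter, mem_powersetCard] at hB
    rw [← hB.1.2]
    exact card_le_card hB.2

end bars

/-! ### Equidistribution -/

theorem sum_asc_subset_eq {N k : ℕ} (hk : 1 ≤ k) (A : Finset ℕ)
    [DecidablePred fun f : Fin (N + 1) → ℕ => Asc f ⊆ A] :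
    ∑ w ∈ URG (N + 1) k with Asc w ⊆ A, (T (bmajMIL w) : ℤ[T;T⁻¹]) =
      ∑ w ∈ URG (N + 1) k with Asc w ⊆ A, T (bmajBAST w) := by
  rw [sum_eq_sum_permClass, sum_eq_sum_permClass]
  have h := sum_permClass_comaj_eq N A fun d =>
    if d ≤ k - 1 then freeBarsGF N (N - d) (k - 1 - d) else 0
  convert h using 2 with σ _ σ _
  · rw [sum_URG_sorted σ hk _ (fun B => T (comaj σ : ℤ) * T (freeWeight (ascents σ) B : ℤ))
      fun w hw hσ => by rw [bmajMIL_eq hw hσ, T_add], ← mul_sum, sum_freeWeight]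
  · rw [sum_URG_sorted σ hk _ (fun B => T (comaj σ + (#(ascents σ) + (σ 0 : ℕ) - N : ℤ)) *
      T (freeWeight (ascents σ) B : ℤ)) fun w hw hσ => by
        rw [bmajBAST_eq hw hσ, bmajMIL_eq hw hσ, ← T_add]; congr 1; ring, ← mul_sum, sum_freeWeight]

/-- Möbius inversion over subsets: a function of finite sets is determined by its sums over the
subsets of each set. -/
theorem eq_of_sum_powerset_eq {R : Type*} [AddCommGroup R] {X Y : Finset ℕ → R}
    (h : ∀ A : Finset ℕ, ∑ B ∈ A.powerset, X B = ∑ B ∈ A.powerset, Y B) (A : Finset ℕ) :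
    X A = Y A := by
  induction A using Finset.strongInduction with
  | H A ih =>
    have hA := h A
    rw [← sum_erase_add _ _ (mem_powerset_self A), ← sum_erase_add _ _ (mem_powerset_self A),
      sum_congr rfl fun B hB => ih B ?_] at hA
    · exact add_left_cancel hA
    · rw [mem_erase, mem_powerset] at hB
      exact hB.2.ssubset_of_ne hB.1

theorem sum_asc_eq {N k : ℕ} (hk : 1 ≤ k) (A : Finset ℕ) :
    ∑ w ∈ URG (N + 1) k with Asc w = A, (T (bmajMIL w) : ℤ[T;T⁻¹]) =
      ∑ w ∈ URG (N + 1) k with Asc w = A, T (bmajBAST w) := by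
  classical
  refine eq_of_sum_powerset_eq (X := fun A => ∑ w ∈ URG (N + 1) k with Asc w = A, T (bmajMIL w))
    (Y := fun A => ∑ w ∈ URG (N + 1) k with Asc w = A, T (bmajBAST w)) (fun A => ?_) A
  have key : ∀ F : (Fin (N + 1) → ℕ) → ℤ[T;T⁻¹], ∑ B ∈ A.powerset,
      ∑ w ∈ URG (N + 1) k with Asc w = B, F w = ∑ w ∈ URG (N + 1) k with Asc w ⊆ A, F w := by
    intro F
    rw [← sum_fiberwise_of_maps_to (g := Asc) (t := A.powerset)
      (fun w hw => mem_powerset.2 (mem_filter.1 hw).2)]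
    refine sum_congr rfl fun B hB => ?_
    rw [filter_filter]
    refine sum_congr (filter_congr fun w _ => ?_) fun _ _ => rfl
    exact (and_iff_right_of_imp fun h => h ▸ mem_powerset.1 hB).symm
  rw [key, key, sum_asc_subset_eq hk]

theorem coeff_sum_T {ι : Type*} (S : Finset ι) (s : ι → ℤ) (m : ℤ) :
    (∑ i ∈ S, (T (s i) : ℤ[T;T⁻¹])).coeff m = #{i ∈ S | s i = m} := by
  rw [AddMonoidAlgebra.coeff_sum, Finsupp.finsetSum_apply, natCast_card_filter]
  exact sum_congr rfl fun i _ => Finsupp.single_apply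

end URGStat

/-- For every set `A` and every value `m`, as many words in `URG(n,k)` have `Asc = A` and
`bmajMIL = m` as have `Asc = A` and `bmajBAST = m`. -/
theorem mainTheorem3 (n k : ℕ) (hk : 1 ≤ k) (hkn : k ≤ n) (A : Finset ℕ) (m : ℤ) :
    ((URGStat.URG n k).filter fun w => URGStat.Asc w = A ∧ URGStat.bmajMIL w = m).card =
      ((URGStat.URG n k).filter fun w => URGStat.Asc w = A ∧ URGStat.bmajBAST w = m).card := by
  obtain ⟨N, rfl⟩ : ∃ N, n = N + 1 := ⟨n - 1, by omega⟩
  have h := congrArg (fun x => x.coeff m) (URGStat.sum_asc_eq (N := N) hk A)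
  simp only [URGStat.coeff_sum_T, Finset.filter_filter] at h
  exact_mod_cast h
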